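/- Let $d\ge 3$, let $\mathbb S^{d-1}$ be the unit sphere of $\mathbb R^d$ with its geodesic distance $\mathrm{dist}(x,y)=\arccos\langle x,y\rangle$, and let $\mathcal P(\mathbb S^{d-1})$ be the set of Borel probability measures on it. For $p\in[1,\infty]$ and $\mu,\nu\in\mathcal P(\mathbb S^{d-1})$ let $W_p(\mu,\nu)$ be the $p$-Wasserstein distance, that is, the infimum of $\|\mathrm{dist}(x,y)\|_{L^p(\gamma)}$ over all couplings $\gamma$ of $\mu$ and $\nu$ (for $p=\infty$ this is the $\gamma$-essential supremum of $\mathrm{dist}$). For $\beta>0$ define the interaction energy $$\mathsf E_\beta[\mu]=\frac1{2\beta}\iint e^{\beta\langle x,y\rangle}\,d\mu(x)\,d\mu(y),\qquad \mu\in\mathcal P(\mathbb S^{d-1}).$$ Then for every $\beta>0$ and every $p\in[1,\infty]$ (in particular for the usual distance $W_2$), every local maximum of $\mathsf E_\beta$ with respect to $W_p$ is a global maximum and a Dirac mass. That is, if $\mu\in\mathcal P(\mathbb S^{d-1})$ and there is $\varepsilon>0$ such that $\mathsf E_\beta[\nu]\le\mathsf E_\beta[\mu]$ for all $\nu\in\mathcal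 P(\mathbb S^{d-1})$ with $W_p(\mu,\nu)<\varepsilon$, then $\mathsf E_\beta[\nu]\le\mathsf E_\beta[\mu]$ for all $\nu\in\mathcal P(\mathbb S^{d-1})$, and $\mu=\delta_{x_0}$ for some $x_0\in\mathbb S^{d-1}$. -/

import Mathlib

open MeasureTheory
open scoped ENNReal

noncomputable section

/-- The unit sphere of `ℝ^d`. -/
abbrev UnitSphere (d : ℕ) : Type :=
  Metric.sphere (0 : EuclideanSpace ℝ (Fin d)) 1

/-- The geodesic distance on the unit sphere: the angle between two unit vectors. -/
def geodesicDist {d : ℕ} (x y : UnitSphere d) : ℝ :=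
  InnerProductGeometry.angle (x : EuclideanSpace ℝ (Fin d)) (y : EuclideanSpace ℝ (Fin d))

/-- The couplings of `μ` and `ν`: the measures on the product with marginals `μ` and `ν`. -/
def couplings {d : ℕ} (μ ν : ProbabilityMeasure (UnitSphere d)) :
    Set (Measure (UnitSphere d × UnitSphere d)) :=
  {γ | γ.fst = (μ : Measure (UnitSphere d)) ∧ γ.snd = (ν : Measure (UnitSphere d))}

/-- The `p`-Wasserstein distance on the probability measures on the sphere, for the geodesic
distance: the infimum over the couplings `γ` of the `L^p(γ)` norm of the distance
(the `γ`-essential supremum of the distance if `p = ∞`). -/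
def wassersteinDist {d : ℕ} (p : ℝ≥0∞) (μ ν : ProbabilityMeasure (UnitSphere d)) : ℝ≥0∞ :=
  ⨅ γ ∈ couplings μ ν, eLpNorm (fun z => geodesicDist z.1 z.2) p γ

/-- The interaction energy `(1 / 2β) ∬ exp (β ⟨x, y⟩) dμ(x) dμ(y)`. -/
def interactionEnergy {d : ℕ} (β : ℝ) (μ : ProbabilityMeasure (UnitSphere d)) : ℝ :=
  1 / (2 * β) *
    ∫ x, ∫ y, Real.exp (β * inner ℝ (x : EuclideanSpace ℝ (Fin d))
      (y : EuclideanSpace ℝ (Fin d))) ∂(μ : Measure (UnitSphere d)) ∂(μ : Measure (UnitSphere d))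

/-- `μ` maximizes `F` on some ball around `μ` for the `p`-Wasserstein distance. -/
def IsWassersteinLocalMax {d : ℕ} (p : ℝ≥0∞) (F : ProbabilityMeasure (UnitSphere d) → ℝ)
    (μ : ProbabilityMeasure (UnitSphere d)) : Prop :=
  ∃ ε : ℝ≥0∞, 0 < ε ∧ ∀ ν : ProbabilityMeasure (UnitSphere d),
    wassersteinDist p μ ν < ε → F ν ≤ F μ

end

/-!
The flow of `x' = v - ⟪x, v⟫ x`, for a unit vector `v`, acts on the sphere by Möbius
transformations, and its time-`t` map sends a pair with inner product `u` to a pair with inner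
product `1 - (1 - u) / (D x * D y)`, where `D x = cosh t + ⟪x, v⟫ sinh t`. Averaging over both time
directions and over `v` in an orthonormal basis of a space of dimension `n`, Parseval's identity
shows that `u` grows by `(1 - u) (n - 2 - u) sinh² t / n` up to an error of order
`(1 - u) sinh⁴ t`. For `n ≥ 3` the leading term is at least `(1 - u)² sinh² t / n`. Since a convex
increasing kernel lies above its tangents, the average energy grows to second order unless
`u = 1` for almost every pair, that is, unless the measure is a Dirac mass. These competitors are
admissible because the flow moves every point by a uniformly small angle.
-/

open Filter Function InnerProductGeometry Metric Set Topology
open scoped RealInnerProductSpace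

section MobiusFlow

variable {E : Type*} [NormedAddCommGroup E] [InnerProductSpace ℝ E]

/-- The conformal denominator of the flow of `x' = v - ⟪x, v⟫ x`: its time-`t` map multiplies the
chordal distance of two points of the unit sphere by
`(mobiusDenom v t x * mobiusDenom v t y) ^ (-1/2)`. -/
noncomputable def mobiusDenom (v : E) (t : ℝ) (x : E) : ℝ :=
  Real.cosh t + ⟪x, v⟫ * Real.sinh t

/-- The explicit formula for the time-`t` map of the flow of `x' = v - ⟪x, v⟫ x` on the unit sphere,
as a map of the ambient space; it is meaningful only where `mobiusDenom v t x ≠ 0`. -/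
noncomputable def mobiusMap (v : E) (t : ℝ) (x : E) : E :=
  (mobiusDenom v t x)⁻¹ • (x + (Real.sinh t + (Real.cosh t - 1) * ⟪x, v⟫) • v)

lemma mobiusDenom_pos {v x : E} (hv : ‖v‖ = 1) (hx : ‖x‖ = 1) (t : ℝ) : 0 < mobiusDenom v t x := by
  have hxv : |⟪x, v⟫| ≤ 1 := by simpa [hv, hx] using abs_real_inner_le_norm x v
  have hlt : |⟪x, v⟫ * Real.sinh t| < Real.cosh t :=
    calc |⟪x, v⟫ * Real.sinh t| ≤ |Real.sinh t| := by
          rw [abs_mul]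
          exact mul_le_of_le_one_left (abs_nonneg _) hxv
      _ = Real.sinh |t| := Real.abs_sinh t
      _ < Real.cosh |t| := Real.sinh_lt_cosh _
      _ = Real.cosh t := Real.cosh_abs t
  unfold mobiusDenom
  linarith [neg_lt_of_abs_lt hlt]

lemma mobiusDenom_mul_mobiusDenom_neg (v : E) (t : ℝ) (x : E) :
    mobiusDenom v t x * mobiusDenom v (-t) x = 1 + (1 - ⟪x, v⟫ ^ 2) * Real.sinh t ^ 2 := by
  simp only [mobiusDenom, Real.cosh_neg, Real.sinh_neg]
  linear_combination Real.cosh_sq t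

lemma inner_mobiusMap {v x y : E} {t : ℝ} (hv : ‖v‖ = 1) (hx : mobiusDenom v t x ≠ 0)
    (hy : mobiusDenom v t y ≠ 0) :
    ⟪mobiusMap v t x, mobiusMap v t y⟫ =
      1 - (1 - ⟪x, y⟫) / (mobiusDenom v t x * mobiusDenom v t y) := by
  have hnum : ⟪x + (Real.sinh t + (Real.cosh t - 1) * ⟪x, v⟫) • v,
      y + (Real.sinh t + (Real.cosh t - 1) * ⟪y, v⟫) • v⟫ =
        mobiusDenom v t x * mobiusDenom v t y - (1 - ⟪x, y⟫) := by
    simp only [mobiusDenom, inner_add_left, inner_add_right, real_inner_smul_left,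
      real_inner_smul_right, real_inner_self_eq_norm_sq, hv, real_inner_comm y v]
    linear_combination (⟪x, v⟫ * ⟪y, v⟫ - 1) * Real.cosh_sq t
  rw [mobiusMap, mobiusMap, real_inner_smul_left, real_inner_smul_right, hnum]
  field_simp

lemma norm_mobiusMap {v x : E} (hv : ‖v‖ = 1) (hx : ‖x‖ = 1) (t : ℝ) : ‖mobiusMap v t x‖ = 1 := by
  have hD := (mobiusDenom_pos hv hx t).ne'
  have hsq : ‖mobiusMap v t x‖ ^ 2 = 1 := by
    rw [← real_inner_self_eq_norm_sq, inner_mobiusMap hv hD hD, real_inner_self_eq_norm_sq, hx]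
    simp
  exact (pow_eq_one_iff_of_nonneg (norm_nonneg _) two_ne_zero).1 hsq

/-- The time-`t` map of the flow of `x' = v - ⟪x, v⟫ x` on the unit sphere. -/
noncomputable def mobiusFlow (v : sphere (0 : E) 1) (t : ℝ) (x : sphere (0 : E) 1) :
    sphere (0 : E) 1 :=
  ⟨mobiusMap v t x, mem_sphere_zero_iff_norm.2
    (norm_mobiusMap (norm_eq_of_mem_sphere v) (norm_eq_of_mem_sphere x) t)⟩

lemma mobiusFlow_zero (v : sphere (0 : E) 1) : mobiusFlow v 0 = id := by
  ext x
  simp [mobiusFlow, mobiusMap, mobiusDenom]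

lemma continuous_mobiusFlow (v : sphere (0 : E) 1) : Continuous (uncurry (mobiusFlow v)) := by
  have hD : Continuous fun z : ℝ × sphere (0 : E) 1 => mobiusDenom (v : E) z.1 z.2 := by
    unfold mobiusDenom
    fun_prop
  refine Continuous.subtype_mk (.smul (hD.inv₀ fun z => ?_) (by fun_prop)) _
  exact (mobiusDenom_pos (norm_eq_of_mem_sphere v) (norm_eq_of_mem_sphere z.2) z.1).ne'

lemma inner_mobiusFlow (v x y : sphere (0 : E) 1) (t : ℝ) :
    ⟪(mobiusFlow v t x : E), mobiusFlow v t y⟫ =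
      1 - (1 - ⟪(x : E), y⟫) / (mobiusDenom (v : E) t x * mobiusDenom (v : E) t y) :=
  have hD (z : sphere (0 : E) 1) : mobiusDenom (v : E) t z ≠ 0 :=
    (mobiusDenom_pos (norm_eq_of_mem_sphere v) (norm_eq_of_mem_sphere z) t).ne'
  inner_mobiusMap (norm_eq_of_mem_sphere v) (hD x) (hD y)

lemma inner_sphere_mem_Icc (x y : sphere (0 : E) 1) : ⟪(x : E), y⟫ ∈ Icc (-1) 1 :=
  real_inner_mem_Icc_of_norm_eq_one (norm_eq_of_mem_sphere x) (norm_eq_of_mem_sphere y)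

end MobiusFlow

section SecondVariation

lemma one_add_mul_div_le {p q m h : ℝ} (hp : p ∈ Icc 0 1) (hq : q ∈ Icc 0 1) (hm : 0 ≤ m)
    (hh : 0 ≤ h) :
    (1 + m * h) / ((1 + p * h) * (1 + q * h)) ≤ 1 + (m - p - q) * h + 4 * h ^ 2 := by
  obtain ⟨hp₀, hp₁⟩ := hp
  obtain ⟨hq₀, hq₁⟩ := hq
  have hden : 0 < 1 + (p + q) * h := by positivity
  calc (1 + m * h) / ((1 + p * h) * (1 + q * h))
      ≤ (1 + m * h) / (1 + (p + q) * h) := by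
        gcongr
        linarith [show 0 ≤ p * q * h ^ 2 by positivity]
    _ ≤ 1 + (m - p - q) * h + 4 * h ^ 2 := by
        rw [div_le_iff₀ hden]
        have hsq : (p + q) ^ 2 ≤ 4 := by nlinarith
        have hrem : 0 ≤ h ^ 2 * ((4 - (p + q) ^ 2) + m * (p + q) + 4 * (p + q) * h) := by
          have := sub_nonneg.2 hsq
          positivity
        linarith

variable {E : Type*} [NormedAddCommGroup E] [InnerProductSpace ℝ E]

lemma inner_mobiusFlow_add_inner_mobiusFlow_neg (v x y : sphere (0 : E) 1) (t : ℝ) :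
    ⟪(mobiusFlow v t x : E), mobiusFlow v t y⟫ + ⟪(mobiusFlow v (-t) x : E), mobiusFlow v (-t) y⟫ =
      2 - 2 * (1 - ⟪(x : E), y⟫) * ((1 + (1 + ⟪(x : E), v⟫ * ⟪(y : E), v⟫) * Real.sinh t ^ 2) /
        ((1 + (1 - ⟪(x : E), v⟫ ^ 2) * Real.sinh t ^ 2) *
          (1 + (1 - ⟪(y : E), v⟫ ^ 2) * Real.sinh t ^ 2))) := by
  have hD (s : ℝ) (z : sphere (0 : E) 1) : mobiusDenom (v : E) s z ≠ 0 :=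
    (mobiusDenom_pos (norm_eq_of_mem_sphere v) (norm_eq_of_mem_sphere z) s).ne'
  have hnum : mobiusDenom (v : E) t x * mobiusDenom (v : E) t y +
      mobiusDenom (v : E) (-t) x * mobiusDenom (v : E) (-t) y =
        2 * (1 + (1 + ⟪(x : E), v⟫ * ⟪(y : E), v⟫) * Real.sinh t ^ 2) := by
    simp only [mobiusDenom, Real.cosh_neg, Real.sinh_neg]
    linear_combination 2 * Real.cosh_sq t
  rw [inner_mobiusFlow, inner_mobiusFlow, ← mobiusDenom_mul_mobiusDenom_neg,
    ← mobiusDenom_mul_mobiusDenom_neg]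
  have := hD t x
  have := hD t y
  have := hD (-t) x
  have := hD (-t) y
  field_simp
  linear_combination -(1 - ⟪(x : E), y⟫) * hnum

lemma le_inner_mobiusFlow_add_inner_mobiusFlow_neg (v x y : sphere (0 : E) 1) (t : ℝ) :
    2 * ⟪(x : E), y⟫ + 2 * (1 - ⟪(x : E), y⟫) *
        ((1 - ⟪(x : E), v⟫ * ⟪(y : E), v⟫ - ⟪(x : E), v⟫ ^ 2 - ⟪(y : E), v⟫ ^ 2) * Real.sinh t ^ 2 -
          4 * (Real.sinh t ^ 2) ^ 2) ≤
      ⟪(mobiusFlow v t x : E), mobiusFlow v t y⟫ +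
        ⟪(mobiusFlow v (-t) x : E), mobiusFlow v (-t) y⟫ := by
  have hsq (z : sphere (0 : E) 1) : 1 - ⟪(z : E), v⟫ ^ 2 ∈ Icc 0 1 := by
    have := (sq_le_one_iff_abs_le_one _).2 (abs_le.2 (inner_sphere_mem_Icc z v))
    exact ⟨by linarith, by linarith [sq_nonneg ⟪(z : E), v⟫]⟩
  have hmul : 0 ≤ 1 + ⟪(x : E), v⟫ * ⟪(y : E), v⟫ := by
    nlinarith [(hsq x).1, (hsq y).1, sq_nonneg (⟪(x : E), v⟫ + ⟪(y : E), v⟫)]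
  have hquot := mul_le_mul_of_nonneg_left
    (one_add_mul_div_le (hsq x) (hsq y) hmul (sq_nonneg (Real.sinh t)))
    (sub_nonneg.2 (inner_sphere_mem_Icc x y).2)
  rw [inner_mobiusFlow_add_inner_mobiusFlow_neg]
  linarith

variable {ι : Type*} [Fintype ι]

/-- The `i`-th vector of an orthonormal basis as a point of the unit sphere. -/
noncomputable def basisPole (b : OrthonormalBasis ι ℝ E) (i : ι) : sphere (0 : E) 1 :=
  ⟨b i, mem_sphere_zero_iff_norm.2 (b.norm_eq_one i)⟩

lemma sum_one_sub_inner_basis (b : OrthonormalBasis ι ℝ E) (x y : sphere (0 : E) 1) :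
    ∑ i, (1 - ⟪(x : E), b i⟫ * ⟪(y : E), b i⟫ - ⟪(x : E), b i⟫ ^ 2 - ⟪(y : E), b i⟫ ^ 2) =
      Fintype.card ι - 2 - ⟪(x : E), y⟫ := by
  have hxy : ∑ i, ⟪(x : E), b i⟫ * ⟪(y : E), b i⟫ = ⟪(x : E), y⟫ := by
    simpa only [real_inner_comm (y : E)] using b.sum_inner_mul_inner (x : E) y
  simp only [Finset.sum_sub_distrib, hxy, b.sum_sq_inner_left, norm_eq_of_mem_sphere,
    Finset.sum_const, Finset.card_univ, nsmul_eq_mul]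
  ring

lemma le_sum_inner_mobiusFlow (b : OrthonormalBasis ι ℝ E) (x y : sphere (0 : E) 1) (t : ℝ) :
    2 * Fintype.card ι * ⟪(x : E), y⟫ + 2 * (1 - ⟪(x : E), y⟫) *
        ((Fintype.card ι - 2 - ⟪(x : E), y⟫) * Real.sinh t ^ 2 -
          4 * Fintype.card ι * (Real.sinh t ^ 2) ^ 2) ≤
      ∑ i, (⟪(mobiusFlow (basisPole b i) t x : E), mobiusFlow (basisPole b i) t y⟫ +
        ⟪(mobiusFlow (basisPole b i) (-t) x : E), mobiusFlow (basisPole b i) (-t) y⟫) := by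
  refine le_trans (le_of_eq ?_) (Finset.sum_le_sum fun i _ =>
    le_inner_mobiusFlow_add_inner_mobiusFlow_neg (basisPole b i) x y t)
  rw [← sum_one_sub_inner_basis b x y]
  simp only [basisPole, Finset.sum_add_distrib, ← Finset.mul_sum, Finset.sum_sub_distrib,
    ← Finset.sum_mul, Finset.sum_const, Finset.card_univ, nsmul_eq_mul]
  ring

end SecondVariation

section Kernel

lemma add_deriv_mul_sub_le_of_convexOn {s : Set ℝ} {K : ℝ → ℝ} (hK : ConvexOn ℝ s K) {u w : ℝ}
    (hu : u ∈ s) (hw : w ∈ s) (hd : DifferentiableAt ℝ K u) :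
    K u + deriv K u * (w - u) ≤ K w := by
  rcases lt_trichotomy u w with huw | rfl | hwu
  · have h := hK.deriv_le_slope hu hw huw hd
    rw [slope_def_field, le_div_iff₀ (sub_pos.2 huw)] at h
    linarith
  · simp
  · have h := hK.slope_le_deriv hw hu hwu hd
    rw [slope_def_field, div_le_iff₀ (sub_pos.2 hwu)] at h
    linarith

variable {E : Type*} [NormedAddCommGroup E] [InnerProductSpace ℝ E]
  {ι : Type*} [Fintype ι] {K : ℝ → ℝ}

lemma le_sum_kernel_inner_mobiusFlow (b : OrthonormalBasis ι ℝ E)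
    (hconv : ConvexOn ℝ (Icc (-1) 1) K) {x y : sphere (0 : E) 1}
    (hdiff : DifferentiableAt ℝ K ⟪(x : E), y⟫) (hderiv : 0 ≤ deriv K ⟪(x : E), y⟫) (t : ℝ) :
    2 * Fintype.card ι * K ⟪(x : E), y⟫ + deriv K ⟪(x : E), y⟫ * (2 * (1 - ⟪(x : E), y⟫) *
        ((Fintype.card ι - 2 - ⟪(x : E), y⟫) * Real.sinh t ^ 2 -
          4 * Fintype.card ι * (Real.sinh t ^ 2) ^ 2)) ≤
      ∑ i, (K ⟪(mobiusFlow (basisPole b i) t x : E), mobiusFlow (basisPole b i) t y⟫ +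
        K ⟪(mobiusFlow (basisPole b i) (-t) x : E), mobiusFlow (basisPole b i) (-t) y⟫) := by
  set u := ⟪(x : E), y⟫
  have htangent (x' y' : sphere (0 : E) 1) :
      K u + deriv K u * (⟪(x' : E), y'⟫ - u) ≤ K ⟪(x' : E), y'⟫ :=
    add_deriv_mul_sub_le_of_convexOn hconv (inner_sphere_mem_Icc x y)
      (inner_sphere_mem_Icc x' y') hdiff
  refine le_trans ?_ (Finset.sum_le_sum fun i _ => add_le_add
    (htangent (mobiusFlow (basisPole b i) t x) (mobiusFlow (basisPole b i) t y))
    (htangent (mobiusFlow (basisPole b i) (-t) x) (mobiusFlow (basisPole b i) (-t) y)))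
  have hgain := mul_le_mul_of_nonneg_left (le_sum_inner_mobiusFlow b x y t) hderiv
  simp only [mul_sub, Finset.sum_add_distrib, Finset.sum_sub_distrib, ← Finset.mul_sum,
    Finset.sum_const, Finset.card_univ, nsmul_eq_mul] at hgain ⊢
  linarith

end Kernel

section Energy

lemma integrable_of_continuous {X : Type*} [TopologicalSpace X] [CompactSpace X]
    [MeasurableSpace X] [OpensMeasurableSpace X] {μ : Measure X} [IsFiniteMeasure μ] {f : X → ℝ}
    (hf : Continuous f) : Integrable f μ :=
  hf.integrable_of_hasCompactSupport (.of_compactSpace _)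

variable {E : Type*} [NormedAddCommGroup E] [InnerProductSpace ℝ E] [MeasurableSpace E]

/-- The energy `∬ K ⟪x, y⟫ dμ(x) dμ(y)` of a measure on the unit sphere for the pair interaction
given by the zonal kernel `K`. -/
noncomputable def kernelEnergy (K : ℝ → ℝ) (μ : Measure (sphere (0 : E) 1)) : ℝ :=
  ∫ z, K ⟪(z.1 : E), z.2⟫ ∂μ.prod μ

variable [BorelSpace E] [FiniteDimensional ℝ E] {K : ℝ → ℝ}

lemma kernelEnergy_map (hK : Continuous K) (μ : Measure (sphere (0 : E) 1)) [IsFiniteMeasure μ]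
    {T : sphere (0 : E) 1 → sphere (0 : E) 1} (hT : Measurable T) :
    kernelEnergy K (μ.map T) = ∫ z, K ⟪(T z.1 : E), T z.2⟫ ∂μ.prod μ := by
  have hf : Continuous fun z : sphere (0 : E) 1 × sphere (0 : E) 1 => K ⟪(z.1 : E), z.2⟫ := by
    fun_prop
  rw [kernelEnergy, Measure.map_prod_map _ _ hT hT,
    integral_map (hT.prodMap hT).aemeasurable hf.aestronglyMeasurable]
  rfl

lemma kernelEnergy_dirac (x : sphere (0 : E) 1) : kernelEnergy K (Measure.dirac x) = K 1 := by
  simp [kernelEnergy, Measure.dirac_prod_dirac, norm_eq_of_mem_sphere]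

lemma kernelEnergy_le (hK : Continuous K) (hle : ∀ u ∈ Icc (-1) 1, K u ≤ K 1)
    (μ : Measure (sphere (0 : E) 1)) [IsProbabilityMeasure μ] : kernelEnergy K μ ≤ K 1 := by
  calc kernelEnergy K μ ≤ ∫ _, K 1 ∂μ.prod μ :=
        integral_mono (integrable_of_continuous (by fun_prop)) (integrable_const _)
          fun z => hle _ (inner_sphere_mem_Icc z.1 z.2)
    _ = K 1 := by simp

variable {ι : Type*} [Fintype ι]

lemma le_sum_kernelEnergy_map_mobiusFlow (b : OrthonormalBasis ι ℝ E) (hK : ContDiff ℝ 1 K)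
    (hconv : ConvexOn ℝ (Icc (-1) 1) K) (hderiv : ∀ u ∈ Icc (-1) 1, 0 ≤ deriv K u)
    (μ : Measure (sphere (0 : E) 1)) [IsFiniteMeasure μ] (t : ℝ) :
    2 * Fintype.card ι * kernelEnergy K μ + ∫ z, deriv K ⟪(z.1 : E), z.2⟫ *
        (2 * (1 - ⟪(z.1 : E), z.2⟫) * ((Fintype.card ι - 2 - ⟪(z.1 : E), z.2⟫) * Real.sinh t ^ 2 -
          4 * Fintype.card ι * (Real.sinh t ^ 2) ^ 2)) ∂μ.prod μ ≤
      ∑ i, (kernelEnergy K (μ.map (mobiusFlow (basisPole b i) t)) +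
        kernelEnergy K (μ.map (mobiusFlow (basisPole b i) (-t)))) := by
  have hKc := hK.continuous
  have := hK.continuous_deriv le_rfl
  have hflow (i : ι) (s : ℝ) : Continuous (mobiusFlow (basisPole b i) s) :=
    (continuous_mobiusFlow (basisPole b i)).uncurry_left s
  have hterm (i : ι) (s : ℝ) : Integrable (fun z : sphere (0 : E) 1 × sphere (0 : E) 1 =>
      K ⟪(mobiusFlow (basisPole b i) s z.1 : E), mobiusFlow (basisPole b i) s z.2⟫) (μ.prod μ) :=
    have hval : Continuous fun x => (mobiusFlow (basisPole b i) s x : E) :=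
      continuous_subtype_val.comp (hflow i s)
    integrable_of_continuous
      (hKc.comp ((hval.comp continuous_fst).inner (hval.comp continuous_snd)))
  simp only [kernelEnergy_map hKc μ (hflow _ _).measurable]
  rw [kernelEnergy, ← integral_const_mul, ← integral_add
    (integrable_of_continuous (by fun_prop)) (integrable_of_continuous (by fun_prop))]
  calc _ ≤ ∫ z : sphere (0 : E) 1 × sphere (0 : E) 1,
        ∑ i, (K ⟪(mobiusFlow (basisPole b i) t z.1 : E), mobiusFlow (basisPole b i) t z.2⟫ +
          K ⟪(mobiusFlow (basisPole b i) (-t) z.1 : E), mobiusFlow (basisPole b i) (-t) z.2⟫)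
          ∂μ.prod μ :=
        integral_mono (integrable_of_continuous (by fun_prop))
          (integrable_finsetSum _ fun i _ => (hterm i t).add (hterm i (-t)))
          fun z => le_sum_kernel_inner_mobiusFlow b hconv (hK.differentiable one_ne_zero _)
            (hderiv _ (inner_sphere_mem_Icc z.1 z.2)) t
    _ = _ := (integral_finsetSum _ fun i _ => (hterm i t).add (hterm i (-t))).trans <|
        Finset.sum_congr rfl fun i _ => integral_add (hterm i t) (hterm i (-t))

lemma integral_deriv_mul_one_sub_inner_sq_le (b : OrthonormalBasis ι ℝ E)
    (hcard : 3 ≤ Fintype.card ι) (hK : ContDiff ℝ 1 K) (hconv : ConvexOn ℝ (Icc (-1) 1) K)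
    (hderiv : ∀ u ∈ Icc (-1) 1, 0 ≤ deriv K u) (μ : Measure (sphere (0 : E) 1)) [IsFiniteMeasure μ]
    {t : ℝ} (ht : t ≠ 0)
    (hle : ∀ i, kernelEnergy K (μ.map (mobiusFlow (basisPole b i) t)) ≤ kernelEnergy K μ ∧
      kernelEnergy K (μ.map (mobiusFlow (basisPole b i) (-t))) ≤ kernelEnergy K μ) :
    ∫ z, deriv K ⟪(z.1 : E), z.2⟫ * (1 - ⟪(z.1 : E), z.2⟫) ^ 2 ∂μ.prod μ ≤
      4 * Fintype.card ι * Real.sinh t ^ 2 *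
        ∫ z, deriv K ⟪(z.1 : E), z.2⟫ * (1 - ⟪(z.1 : E), z.2⟫) ∂μ.prod μ := by
  have := hK.continuous_deriv le_rfl
  have hsinh : 0 < Real.sinh t ^ 2 := sq_pos_of_ne_zero (Real.sinh_eq_zero.not.2 ht)
  have hcard' : (3 : ℝ) ≤ Fintype.card ι := by exact_mod_cast hcard
  have hupper : ∑ i, (kernelEnergy K (μ.map (mobiusFlow (basisPole b i) t)) +
      kernelEnergy K (μ.map (mobiusFlow (basisPole b i) (-t)))) ≤
        2 * Fintype.card ι * kernelEnergy K μ :=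
    calc _ ≤ ∑ _i : ι, (kernelEnergy K μ + kernelEnergy K μ) :=
          Finset.sum_le_sum fun i _ => add_le_add (hle i).1 (hle i).2
      _ = 2 * Fintype.card ι * kernelEnergy K μ := by
          rw [Finset.sum_const, Finset.card_univ, nsmul_eq_mul]
          ring
  have hgain := (add_le_iff_nonpos_right _).1
    ((le_sum_kernelEnergy_map_mobiusFlow b hK hconv hderiv μ t).trans hupper)
  have hdim : 2 * Real.sinh t ^ 2 *
      ∫ z, (deriv K ⟪(z.1 : E), z.2⟫ * (1 - ⟪(z.1 : E), z.2⟫) ^ 2 -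
        4 * Fintype.card ι * Real.sinh t ^ 2 *
          (deriv K ⟪(z.1 : E), z.2⟫ * (1 - ⟪(z.1 : E), z.2⟫))) ∂μ.prod μ ≤ 0 := by
    rw [← integral_const_mul]
    refine (integral_mono (integrable_of_continuous (by fun_prop))
      (integrable_of_continuous (by fun_prop)) fun z => ?_).trans hgain
    have hu := inner_sphere_mem_Icc z.1 z.2
    have : 0 ≤ deriv K ⟪(z.1 : E), z.2⟫ * (1 - ⟪(z.1 : E), z.2⟫) * (Fintype.card ι - 3) *
        (2 * Real.sinh t ^ 2) :=
      mul_nonneg (mul_nonneg (mul_nonneg (hderiv _ hu) (sub_nonneg.2 hu.2))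
        (sub_nonneg.2 hcard')) (by positivity)
    linarith
  have hnonpos := nonpos_of_mul_nonpos_right hdim (mul_pos two_pos hsinh)
  rw [integral_sub (integrable_of_continuous (by fun_prop))
    (integrable_of_continuous (by fun_prop)), integral_const_mul] at hnonpos
  exact sub_nonpos.1 hnonpos

end Energy

section Dirac

lemma exists_eq_dirac_of_ae_fst_eq_snd {X : Type*} [MeasurableSpace X] {μ : Measure X}
    [IsProbabilityMeasure μ] (h : ∀ᵐ z ∂μ.prod μ, z.1 = z.2) :
    ∃ x₀, μ = Measure.dirac x₀ := by
  obtain ⟨x₀, hx₀⟩ := (Measure.ae_ae_of_ae_prod h).exists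
  refine ⟨x₀, ?_⟩
  calc μ = μ.map id := Measure.map_id.symm
    _ = μ.map fun _ => x₀ := Measure.map_congr (hx₀.mono fun _ hy => hy.symm)
    _ = Measure.dirac x₀ := by simp

variable {E : Type*} [NormedAddCommGroup E] [InnerProductSpace ℝ E] [MeasurableSpace E]
  [BorelSpace E] [FiniteDimensional ℝ E] {ι : Type*} [Fintype ι] {K : ℝ → ℝ}

lemma exists_eq_dirac_of_eventually_kernelEnergy_map_le (b : OrthonormalBasis ι ℝ E)
    (hcard : 3 ≤ Fintype.card ι) (hK : ContDiff ℝ 1 K) (hconv : ConvexOn ℝ (Icc (-1) 1) K)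
    (hderiv : ∀ u ∈ Icc (-1) 1, 0 < deriv K u) (μ : Measure (sphere (0 : E) 1))
    [IsProbabilityMeasure μ]
    (hle : ∀ i, ∀ᶠ t in 𝓝 0,
      kernelEnergy K (μ.map (mobiusFlow (basisPole b i) t)) ≤ kernelEnergy K μ) :
    ∃ x₀, μ = Measure.dirac x₀ := by
  have := hK.continuous_deriv le_rfl
  have hle_neg := fun i => (continuous_neg.tendsto' (0 : ℝ) 0 neg_zero).eventually (hle i)
  have hlim : Tendsto (fun t => 4 * Fintype.card ι * Real.sinh t ^ 2 *
      ∫ z, deriv K ⟪(z.1 : E), z.2⟫ * (1 - ⟪(z.1 : E), z.2⟫) ∂μ.prod μ) (𝓝[≠] 0) (𝓝 0) :=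
    (Continuous.tendsto' (by fun_prop) 0 0 (by simp)).mono_left nhdsWithin_le_nhds
  have hnonpos : ∫ z, deriv K ⟪(z.1 : E), z.2⟫ * (1 - ⟪(z.1 : E), z.2⟫) ^ 2 ∂μ.prod μ ≤ 0 := by
    refine ge_of_tendsto hlim ?_
    filter_upwards [self_mem_nhdsWithin, nhdsWithin_le_nhds (eventually_all.2 hle),
      nhdsWithin_le_nhds (eventually_all.2 hle_neg)] with t ht hpos hneg
    exact integral_deriv_mul_one_sub_inner_sq_le b hcard hK hconv (fun u hu => (hderiv u hu).le) μ
      ht fun i => ⟨hpos i, hneg i⟩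
  have hnonneg (z : sphere (0 : E) 1 × sphere (0 : E) 1) :
      0 ≤ deriv K ⟪(z.1 : E), z.2⟫ * (1 - ⟪(z.1 : E), z.2⟫) ^ 2 :=
    mul_nonneg (hderiv _ (inner_sphere_mem_Icc z.1 z.2)).le (sq_nonneg _)
  have hzero := (integral_eq_zero_iff_of_nonneg hnonneg
    (integrable_of_continuous (by fun_prop))).1 (hnonpos.antisymm (integral_nonneg hnonneg))
  refine exists_eq_dirac_of_ae_fst_eq_snd (hzero.mono fun z hz => Subtype.ext ?_)
  have hsq := (mul_eq_zero.1 hz).resolve_left (hderiv _ (inner_sphere_mem_Icc z.1 z.2)).ne'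
  exact (inner_eq_one_iff_of_norm_eq_one (norm_eq_of_mem_sphere z.1)
    (norm_eq_of_mem_sphere z.2)).1 (sub_eq_zero.1 (pow_eq_zero_iff two_ne_zero |>.1 hsq)).symm

end Dirac

section Wasserstein

variable {d : ℕ}

lemma continuous_geodesicDist :
    Continuous fun z : UnitSphere d × UnitSphere d => geodesicDist z.1 z.2 := by
  simp only [geodesicDist, angle, norm_eq_of_mem_sphere]
  fun_prop

lemma wassersteinDist_map_le (p : ℝ≥0∞) (μ : ProbabilityMeasure (UnitSphere d))
    {T : UnitSphere d → UnitSphere d} (hT : Measurable T) {C : ℝ}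
    (hC : ∀ x, geodesicDist x (T x) ≤ C) :
    wassersteinDist p μ (μ.map hT.aemeasurable) ≤ ENNReal.ofReal C := by
  have hgraph : Measurable fun x => (x, T x) := measurable_id.prodMk hT
  have hcoupling : (μ : Measure (UnitSphere d)).map (fun x => (x, T x)) ∈
      couplings μ (μ.map hT.aemeasurable) := by
    constructor
    · rw [Measure.fst, Measure.map_map measurable_fst hgraph]
      exact Measure.map_id
    · rw [Measure.snd, Measure.map_map measurable_snd hgraph]
      rfl
  calc wassersteinDist p μ (μ.map hT.aemeasurable)
      ≤ eLpNorm (fun z => geodesicDist z.1 z.2) p (μ.toMeasure.map fun x => (x, T x)) :=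
        iInf₂_le _ hcoupling
    _ = eLpNorm (fun x => geodesicDist x (T x)) p μ :=
        eLpNorm_map_measure continuous_geodesicDist.aestronglyMeasurable hgraph.aemeasurable
    _ ≤ μ.toMeasure univ ^ p.toReal⁻¹ * ENNReal.ofReal C :=
        eLpNorm_le_of_ae_bound (ae_of_all _ fun x =>
          (Real.norm_of_nonneg (angle_nonneg _ _)).trans_le (hC x))
    _ = ENNReal.ofReal C := by simp

lemma eventually_forall_geodesicDist_lt {X : Type*} [TopologicalSpace X]
    {T : X → UnitSphere d → UnitSphere d} (hT : Continuous (uncurry T)) {a : X} (ha : T a = id)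
    {C : ℝ} (hC : 0 < C) : ∀ᶠ t in 𝓝 a, ∀ x, geodesicDist x (T t x) < C := by
  have hdist : Continuous fun z : X × UnitSphere d => geodesicDist z.2 (T z.1 z.2) :=
    (continuous_geodesicDist (d := d)).comp₂ continuous_snd hT
  have hself (x : UnitSphere d) : geodesicDist x (T a x) < C := by
    simpa [ha, geodesicDist, angle_self (ne_zero_of_mem_unit_sphere x)] using hC
  have hlt (x : UnitSphere d) (_ : x ∈ univ) :
      ∀ᶠ z : X × UnitSphere d in 𝓝 (a, x), geodesicDist z.2 (T z.1 z.2) < C :=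
    (hdist.tendsto (a, x)).eventually_lt_const (hself x)
  exact (isCompact_univ.eventually_forall_of_forall_eventually
    (P := fun t x => geodesicDist x (T t x) < C) hlt).mono fun t ht x => ht x (mem_univ x)

lemma IsWassersteinLocalMax.eventually_map_le {p : ℝ≥0∞} {F : ProbabilityMeasure (UnitSphere d) → ℝ}
    {μ : ProbabilityMeasure (UnitSphere d)} (hμ : IsWassersteinLocalMax p F μ) {X : Type*}
    [TopologicalSpace X] {T : X → UnitSphere d → UnitSphere d} (hT : Continuous (uncurry T)) {a : X}
    (ha : T a = id) :
    ∀ᶠ t in 𝓝 a, F (μ.map (hT.uncurry_left t).measurable.aemeasurable) ≤ F μ := by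
  obtain ⟨ε, hε, hmax⟩ := hμ
  obtain ⟨C, hC, hCε⟩ := ENNReal.lt_iff_exists_nnreal_btwn.1 hε
  filter_upwards [eventually_forall_geodesicDist_lt hT ha
    (NNReal.coe_pos.2 (ENNReal.coe_pos.1 hC))] with t ht
  refine hmax _ ((wassersteinDist_map_le p μ (hT.uncurry_left t).measurable
    fun x => (ht x).le).trans_lt ?_)
  simpa using hCε

end Wasserstein

theorem mainTheorem4_general {d : ℕ} (hd : 3 ≤ d) {K : ℝ → ℝ} (hK : ContDiff ℝ 1 K)
    (hconv : ConvexOn ℝ (Icc (-1) 1) K) (hderiv : ∀ u ∈ Icc (-1) 1, 0 < deriv K u) {p : ℝ≥0∞}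
    {μ : ProbabilityMeasure (UnitSphere d)}
    (hμ : IsWassersteinLocalMax p (fun ν => kernelEnergy K (ν : Measure (UnitSphere d))) μ) :
    (∀ ν : ProbabilityMeasure (UnitSphere d),
        kernelEnergy K (ν : Measure (UnitSphere d)) ≤ kernelEnergy K (μ : Measure (UnitSphere d))) ∧
      ∃ x₀ : UnitSphere d, (μ : Measure (UnitSphere d)) = Measure.dirac x₀ := by
  obtain ⟨x₀, hx₀⟩ : ∃ x₀ : UnitSphere d, (μ : Measure (UnitSphere d)) = Measure.dirac x₀ :=
    exists_eq_dirac_of_eventually_kernelEnergy_map_le (EuclideanSpace.basisFun (Fin d) ℝ)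
      (by simpa using hd) hK hconv hderiv μ fun i =>
        hμ.eventually_map_le (continuous_mobiusFlow _) (mobiusFlow_zero _)
  have hle (u : ℝ) (hu : u ∈ Icc (-1) 1) : K u ≤ K 1 := by
    have htangent := add_deriv_mul_sub_le_of_convexOn hconv hu (right_mem_Icc.2 (by norm_num))
      (hK.differentiable one_ne_zero u)
    linarith [mul_nonneg (hderiv u hu).le (sub_nonneg.2 hu.2)]
  refine ⟨fun ν => ?_, x₀, hx₀⟩
  rw [hx₀, kernelEnergy_dirac]
  exact kernelEnergy_le hK.continuous hle (ν : Measure (UnitSphere d))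

section ExponentialKernel

/-- The kernel `u ↦ exp (β u) / (2 β)` of the interaction energy. -/
noncomputable def expKernel (β u : ℝ) : ℝ :=
  1 / (2 * β) * Real.exp (β * u)

lemma interactionEnergy_eq_kernelEnergy {d : ℕ} (β : ℝ) :
    interactionEnergy β = fun μ : ProbabilityMeasure (UnitSphere d) =>
      kernelEnergy (expKernel β) (μ : Measure (UnitSphere d)) := by
  funext μ
  simp only [interactionEnergy, kernelEnergy, expKernel]
  rw [integral_const_mul, integral_prod _ (integrable_of_continuous (by fun_prop))]

lemma contDiff_expKernel (β : ℝ) : ContDiff ℝ 1 (expKernel β) := by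
  unfold expKernel
  fun_prop

lemma convexOn_expKernel {β : ℝ} (hβ : 0 ≤ β) : ConvexOn ℝ univ (expKernel β) :=
  (convexOn_exp.comp_linearMap (LinearMap.mulLeft ℝ β)).smul (by positivity)

lemma deriv_expKernel_pos {β : ℝ} (hβ : β ≠ 0) (u : ℝ) : 0 < deriv (expKernel β) u := by
  have hderiv : HasDerivAt (expKernel β) (1 / (2 * β) * (Real.exp (β * u) * (β * 1))) u :=
    (((hasDerivAt_id u).const_mul β).exp).const_mul _
  have hval : 1 / (2 * β) * (Real.exp (β * u) * (β * 1)) = Real.exp (β * u) / 2 := by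
    field_simp
  rw [hderiv.deriv, hval]
  positivity

end ExponentialKernel

theorem mainTheorem4 (d : ℕ) (hd : 3 ≤ d) (β : ℝ) (hβ : 0 < β) (p : ℝ≥0∞) (hp : 1 ≤ p)
    (μ : ProbabilityMeasure (UnitSphere d))
    (hμ : IsWassersteinLocalMax p (interactionEnergy β) μ) :
    (∀ ν : ProbabilityMeasure (UnitSphere d), interactionEnergy β ν ≤ interactionEnergy β μ) ∧
      ∃ x₀ : UnitSphere d, (μ : Measure (UnitSphere d)) = Measure.dirac x₀ := by
  rw [interactionEnergy_eq_kernelEnergy] at hμ ⊢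
  exact mainTheorem4_general hd (contDiff_expKernel β)
    ((convexOn_expKernel hβ.le).subset (subset_univ _) (convex_Icc _ _))
    (fun u _ => deriv_expKernel_pos hβ.ne' u) hμ
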